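/- Exponent sequences are families $r=(r_\beta)$ of real numbers indexed by all ordinals such that for some ordinal $\alpha$ we have $r_\beta=0$ for all $\beta\ge\alpha$. Let $\mathfrak L$ be the ordered abelian group of formal monomials $\ell^r=\prod_\beta \ell_\beta^{r_\beta}$, with $\ell^r\cdot\ell^s=\ell^{r+s}$ and $\ell^r\prec\ell^s$ iff $r_\beta<s_\beta$ at the least $\beta$ with $r_\beta\neq s_\beta$. Let $\mathfrak L_{<\alpha}$ be the subgroup of the $\ell^r$ with $r_\beta=0$ for all $\beta\ge\alpha$, let $\mathbb L_{<\alpha}=\mathbb R[[\mathfrak L_{<\alpha}]]$ be the ordered Hahn field of well-based series over $\mathbb R$ with monomials in $\mathfrak L_{<\alpha}$ (a nonzero series being positive iff its leading coefficient is positive), and let $\mathbb L=\bigcup_\alpha\mathbb L_{<\alpha}$, an ordered field extension of $\mathbb R$. Let $\partial$ be the $\mathbb R$-linear derivation on $\mathbb L$ that commutes with infinite sums and satisfies $$\partial(\ell^r)=\sum_\beta r_\beta\,\ell^r\prod_{\gamma\le\beta}\ell_\gamma^{-1}\quad\text{for all exponent sequences } r;$$ in particular $\partial\ell_\alpha=\prod_{\beta<\alpha}\ell_\beta^{-1}$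 for all $\alpha$. An $H$-field is an ordered field $K$ with a derivation $\partial$ such that, with $C=\{c\in K:\partial c=0\}$: (1) if $f\in K$ and $f>C$, then $\partial f>0$; (2) if $f\in K$ lies in the convex hull of $C$ in $K$, then $f=c+\varepsilon$ for some $c\in C$ and $\varepsilon\in K$ with $|\varepsilon|<d$ for all $d\in C$ with $d>0$. **Theorem.** $\{f\in\mathbb L:\partial f=0\}=\mathbb R$, $(\mathbb L,\partial)$ is an $H$-field, and $\partial\mathbb L=\mathbb L$. Consequently there is an operator $\int:\mathbb L\to\mathbb L$ that assigns to each $f\in\mathbb L$ the unique $g\in\mathbb L$ with $\partial g=f$ and $1\notin\operatorname{supp} g$. -/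

import Mathlib

universe u

noncomputable section

namespace LogHyper

/-- Exponent sequences: families `(r_β)` of reals indexed by all ordinals such that for some `α`
we have `r_β = 0` for all `β ≥ α`. They form an additive group, ordered lexicographically: `r < s`
iff `r_β < s_β` at the least `β` with `r_β ≠ s_β`. This is the ordered group of logarithmic
hypermonomials `ℓ^r = ∏_β ℓ_β ^ r_β` (with `≺` as ordering), written additively. -/
def Exponents : AddSubgroup (Lex (Ordinal.{u} → ℝ)) where
  carrier := {r | ∃ α, ∀ β, α ≤ β → r β = 0}
  zero_mem' := ⟨0, fun _ _ => rfl⟩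
  add_mem' := by
    rintro r s ⟨a, ha⟩ ⟨b, hb⟩
    refine ⟨max a b, fun β hβ => ?_⟩
    change r β + s β = 0
    rw [ha β ((le_max_left _ _).trans hβ), hb β ((le_max_right _ _).trans hβ), add_zero]
  neg_mem' := by
    rintro r ⟨a, ha⟩
    refine ⟨a, fun β hβ => ?_⟩
    change -r β = 0
    rw [ha β hβ, neg_zero]

/-- The exponent `r_β`. -/
def expo (r : Exponents.{u}) (β : Ordinal.{u}) : ℝ := r.1 β

@[simp] lemma expo_zero (β : Ordinal.{u}) : expo 0 β = 0 := rfl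
@[simp] lemma expo_add (r s : Exponents.{u}) (β : Ordinal.{u}) :
    expo (r + s) β = expo r β + expo s β := rfl
@[simp] lemma expo_neg (r : Exponents.{u}) (β : Ordinal.{u}) : expo (-r) β = -expo r β := rfl

/-- The group `𝔏_{<α}` of hypermonomials `ℓ^r` with `r_β = 0` for all `β ≥ α`. -/
def exponentsBelow (α : Ordinal.{u}) : AddSubgroup Exponents.{u} where
  carrier := {r | ∀ β, α ≤ β → expo r β = 0}
  zero_mem' := fun _ _ => rfl
  add_mem' := fun {r s} hr hs β hβ => by simp [hr β hβ, hs β hβ]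
  neg_mem' := fun {r} hr β hβ => by simp [hr β hβ]

lemma exponentsBelow_mono {α β : Ordinal.{u}} (h : α ≤ β) :
    exponentsBelow α ≤ exponentsBelow β :=
  fun _ hr γ hγ => hr γ (h.trans hγ)

lemma exists_mem_exponentsBelow (r : Exponents.{u}) : ∃ α, r ∈ exponentsBelow α := r.2

/-- The exponent sequence of the hyperlogarithm `ℓ_α`. -/
def ellExp (α : Ordinal.{u}) : Exponents.{u} :=
  ⟨toLex fun β => if β = α then 1 else 0, Order.succ α, fun _β hβ =>
    if_neg ((Order.lt_succ α).trans_le hβ).ne'⟩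

/-- The exponent sequence of `∏_{β<α} ℓ_β⁻¹`. -/
def ellDerivExp (α : Ordinal.{u}) : Exponents.{u} :=
  ⟨toLex fun β => if β < α then -1 else 0, α, fun _β hβ => if_neg hβ.not_gt⟩

/-- The exponent sequence of `ℓ_β^† = ∏_{γ≤β} ℓ_γ⁻¹`. -/
def ellDaggerExp (β : Ordinal.{u}) : Exponents.{u} := ellDerivExp (Order.succ β)

lemma ellDerivExp_mem (α : Ordinal.{u}) : ellDerivExp α ∈ exponentsBelow α :=
  fun _ hβ => if_neg hβ.not_gt

lemma ellExp_mem (α : Ordinal.{u}) : ellExp α ∈ exponentsBelow (Order.succ α) :=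
  fun _ hβ => if_neg ((Order.lt_succ α).trans_le hβ).ne'

lemma ellExp_add_ellDaggerExp (α : Ordinal.{u}) :
    ellExp α + ellDaggerExp α = ellDerivExp α := by
  apply Subtype.ext
  funext β
  change (if β = α then (1 : ℝ) else 0) + (if β < Order.succ α then -1 else 0)
    = if β < α then -1 else 0
  rcases lt_trichotomy β α with h | rfl | h
  · simp [h.ne, h, h.le]
  · simp
  · simp [h.ne', h.not_gt, h.not_ge]

lemma ellDaggerExp_antitone : Antitone ellDaggerExp.{u} := by
  intro α β h
  rcases h.eq_or_lt with rfl | h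
  · exact le_rfl
  have hlt : (ellDaggerExp β).1 < (ellDaggerExp α).1 := by
    refine ⟨Order.succ α, fun γ hγ => ?_, ?_⟩
    · have h1 : γ ≤ α := Order.lt_succ_iff.1 hγ
      change (if γ < Order.succ β then (-1 : ℝ) else 0) = if γ < Order.succ α then -1 else 0
      rw [if_pos (Order.lt_succ_iff.2 (h1.trans h.le)), if_pos hγ]
    · change (if Order.succ α < Order.succ β then (-1 : ℝ) else 0)
        < if Order.succ α < Order.succ α then -1 else 0
      rw [if_pos (Order.succ_lt_succ h), if_neg (lt_irrefl _)]
      norm_num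
  exact hlt.le

/-- Hahn series with real coefficients and monomials in the class of all hypermonomials. The index
group carries the opposite order since supports are to be well-ordered for the reverse of `≺`. The
coefficient of `ℓ^r` is `f.coeff (OrderDual.toDual r)`. -/
abbrev Series : Type (u + 1) := HahnSeries (Exponents.{u})ᵒᵈ ℝ

/-- `f` is a series with monomials in `𝔏_{<α}`, i.e. an element of the Hahn field `𝕃_{<α}`. -/
def IsBelow (α : Ordinal.{u}) (f : Series.{u}) : Prop :=
  ∀ r ∈ f.support, OrderDual.ofDual r ∈ exponentsBelow α

lemma IsBelow.mono {α β : Ordinal.{u}} (h : α ≤ β) {f : Series.{u}} (hf : IsBelow α f) :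
    IsBelow β f := fun r hr => exponentsBelow_mono h (hf r hr)

lemma IsBelow.add {α : Ordinal.{u}} {f g : Series.{u}} (hf : IsBelow α f) (hg : IsBelow α g) :
    IsBelow α (f + g) := fun r hr =>
  (HahnSeries.support_add_subset f g hr).elim (hf r) (hg r)

lemma IsBelow.mul {α : Ordinal.{u}} {f g : Series.{u}} (hf : IsBelow α f) (hg : IsBelow α g) :
    IsBelow α (f * g) := by
  intro r hr
  obtain ⟨a, ha, b, hb, rfl⟩ := Set.mem_add.1 (HahnSeries.support_mul_subset hr)
  exact (exponentsBelow α).add_mem (hf a ha) (hg b hb)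

lemma isBelow_single {α : Ordinal.{u}} {r : Exponents.{u}} (hr : r ∈ exponentsBelow α) (c : ℝ) :
    IsBelow α (HahnSeries.single (OrderDual.toDual r) c) := by
  intro s hs
  rw [Set.mem_singleton_iff.1 (HahnSeries.support_single_subset hs)]
  exact hr

lemma isBelow_algebraMap (α : Ordinal.{u}) (c : ℝ) : IsBelow α (algebraMap ℝ Series.{u} c) :=
  isBelow_single (α := α) (r := 0) (exponentsBelow α).zero_mem c

/-- The inclusion of monomial groups `𝔏_{<α} → 𝔏`. -/
def belowHom (α : Ordinal.{u}) : (exponentsBelow α)ᵒᵈ →+ (Exponents.{u})ᵒᵈ where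
  toFun r := OrderDual.toDual (OrderDual.ofDual r).1
  map_zero' := rfl
  map_add' _ _ := rfl

lemma belowHom_injective (α : Ordinal.{u}) : Function.Injective (belowHom α) :=
  fun _ _ h => Subtype.ext h

lemma IsBelow.inv {α : Ordinal.{u}} {f : Series.{u}} (hf : IsBelow α f) : IsBelow α f⁻¹ := by
  let φ : HahnSeries (exponentsBelow α)ᵒᵈ ℝ →+* Series.{u} :=
    HahnSeries.embDomainRingHom (belowHom α) (belowHom_injective α) fun _ _ => Iff.rfl
  let e : (exponentsBelow α)ᵒᵈ ↪o (Exponents.{u})ᵒᵈ :=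
    ⟨⟨belowHom α, belowHom_injective α⟩, Iff.rfl⟩
  have hφ : ∀ g, φ g = HahnSeries.embDomain e g := fun _ => rfl
  have hrange : ∀ g, IsBelow α (φ g) := by
    intro g r hr
    rw [hφ] at hr
    obtain ⟨s, -, rfl⟩ := HahnSeries.support_embDomain_subset hr
    exact (OrderDual.ofDual s).2
  have hpwo : Set.IsPWO {r : (exponentsBelow α)ᵒᵈ | f.coeff (belowHom α r) ≠ 0} := by
    rw [Set.isPWO_iff_isWF]
    have := f.isWF_support
    refine Set.isWF_iff_no_descending_seq.2 fun s hs hmem => ?_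
    exact Set.isWF_iff_no_descending_seq.1 this (fun n => e (s n))
      (fun m n hmn => e.lt_iff_lt.2 (hs hmn)) fun n => hmem n
  let g : HahnSeries (exponentsBelow α)ᵒᵈ ℝ := ⟨fun r => f.coeff (belowHom α r), hpwo⟩
  have hg : φ g = f := by
    rw [hφ]
    ext r
    by_cases hr : OrderDual.ofDual r ∈ exponentsBelow α
    · exact HahnSeries.embDomain_coeff (f := e) (x := g) (a := OrderDual.toDual ⟨_, hr⟩)
    · rw [HahnSeries.embDomain_of_notMem_range]
      · by_contra h
        exact hr (hf r (Ne.symm h))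
      · rintro ⟨s, rfl⟩
        exact hr (OrderDual.ofDual s).2
  rw [← hg, ← map_inv₀]
  exact hrange _

/-- The field `𝕃 = ⋃_α ℝ[[𝔏_{<α}]]` of logarithmic hyperseries. -/
def LL : IntermediateField ℝ Series.{u} where
  carrier := {f | ∃ α, IsBelow α f}
  add_mem' := by
    rintro f g ⟨a, ha⟩ ⟨b, hb⟩
    exact ⟨max a b, (ha.mono (le_max_left _ _)).add (hb.mono (le_max_right _ _))⟩
  mul_mem' := by
    rintro f g ⟨a, ha⟩ ⟨b, hb⟩
    exact ⟨max a b, (ha.mono (le_max_left _ _)).mul (hb.mono (le_max_right _ _))⟩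
  algebraMap_mem' c := ⟨0, isBelow_algebraMap 0 c⟩
  inv_mem' := by
    rintro f ⟨a, ha⟩
    exact ⟨a, ha.inv⟩

/-- The ordering of `𝕃`: `f < g` iff `f_𝔪 < g_𝔪` for the `≺`-largest `𝔪` with `f_𝔪 ≠ g_𝔪`;
equivalently, `f > 0` iff `f ≠ 0` and the leading coefficient of `f` is positive. -/
instance : LinearOrder LL.{u} :=
  LinearOrder.lift' (fun f : LL.{u} => toLex f.1) fun _ _ h => Subtype.ext h

instance : IsStrictOrderedRing LL.{u} :=
  Function.Injective.isStrictOrderedRing (fun f : LL.{u} => toLex f.1) rfl rfl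
    (fun _ _ => rfl) (fun _ _ => rfl) Iff.rfl Iff.rfl

/-- The hypermonomial `ℓ^r` as an element of `𝕃`. -/
def mono (r : Exponents.{u}) : LL.{u} :=
  ⟨HahnSeries.single (OrderDual.toDual r) 1, by
    obtain ⟨α, hα⟩ := exists_mem_exponentsBelow r
    exact ⟨α, isBelow_single hα 1⟩⟩

/-- The support of `f ∈ 𝕃`, a class of hypermonomials. -/
def supp (f : LL.{u}) : Set Exponents.{u} := {r | f.1.coeff (OrderDual.toDual r) ≠ 0}

/-- `∑_r f_r ℓ^r ↦ ∑_r r_β f_r ℓ^r`. -/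
def weight (β : Ordinal.{u}) : Series.{u} →ₗ[ℝ] Series.{u} where
  toFun f := ⟨fun r => expo (OrderDual.ofDual r) β * f.coeff r,
    f.isPWO_support.mono fun _ hr => right_ne_zero_of_mul hr⟩
  map_add' f g := by ext r; simp [mul_add]
  map_smul' c f := by ext r; simp; ring

@[simp] lemma weight_coeff (β : Ordinal.{u}) (f : Series.{u}) (r : (Exponents.{u})ᵒᵈ) :
    (weight β f).coeff r = expo (OrderDual.ofDual r) β * f.coeff r := rfl

lemma support_weight_subset (β : Ordinal.{u}) (f : Series.{u}) :
    (weight β f).support ⊆ f.support := fun _ hr => right_ne_zero_of_mul hr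

lemma weight_mul (β : Ordinal.{u}) (f g : Series.{u}) :
    weight β (f * g) = f * weight β g + g * weight β f := by
  ext r
  rw [mul_comm g, HahnSeries.coeff_add, weight_coeff, HahnSeries.coeff_mul,
    HahnSeries.coeff_mul_left' f.isPWO_support (support_weight_subset β f)]
  rw [HahnSeries.coeff_mul_right' g.isPWO_support (support_weight_subset β g), Finset.mul_sum,
    ← Finset.sum_add_distrib]
  refine Finset.sum_congr rfl fun p hp => ?_
  obtain ⟨-, -, rfl⟩ := Finset.mem_antidiagonal.1 hp
  simp only [weight_coeff, ofDual_add, expo_add]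
  ring

/-- `ℓ_β^† = ∏_{γ≤β} ℓ_γ⁻¹` as a series. -/
def dagger (β : Ordinal.{u}) : Series.{u} :=
  HahnSeries.single (OrderDual.toDual (ellDaggerExp β)) 1

lemma coeff_dagger_mul (β : Ordinal.{u}) (f : Series.{u}) (r : (Exponents.{u})ᵒᵈ) :
    (dagger β * f).coeff r = f.coeff (r - OrderDual.toDual (ellDaggerExp β)) := by
  have := HahnSeries.coeff_single_mul_add (r := (1 : ℝ)) (x := f)
    (a := r - OrderDual.toDual (ellDaggerExp β)) (b := OrderDual.toDual (ellDaggerExp β))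
  rw [sub_add_cancel, one_mul] at this
  exact this

lemma isPWO_range_dagger :
    (Set.range fun β : Ordinal.{u} => OrderDual.toDual (ellDaggerExp β)).IsPWO := by
  have hm : Monotone fun β : Ordinal.{u} => OrderDual.toDual (ellDaggerExp β) :=
    fun _ _ h => ellDaggerExp_antitone h
  rw [← Set.image_univ]
  exact Set.IsPWO.image_of_monotone (Set.isPWO_of_wellQuasiOrderedLE _) hm

lemma ellDaggerExp_injective : Function.Injective ellDaggerExp.{u} := by
  intro α β h
  by_contra hne
  wlog hlt : α < β generalizing α β
  · exact this h.symm (Ne.symm hne) (lt_of_le_of_ne (not_lt.1 hlt) (Ne.symm hne))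
  have : expo (ellDaggerExp α) β = expo (ellDaggerExp β) β := by rw [h]
  simp [expo, ellDaggerExp, ellDerivExp, hlt.not_ge] at this

/-- For `f = ∑_r f_r ℓ^r` the summable family, indexed by the ordinals `β`, of the series
`ℓ_β^† ∑_r r_β f_r ℓ^r`. -/
def derFamily (f : Series.{u}) :
    HahnSeries.SummableFamily (Exponents.{u})ᵒᵈ ℝ Ordinal.{u} where
  toFun β := dagger β * weight β f
  isPWO_iUnion_support' := by
    refine (isPWO_range_dagger.add f.isPWO_support).mono ?_
    refine Set.iUnion_subset fun β r hr => ?_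
    rw [HahnSeries.mem_support, coeff_dagger_mul] at hr
    exact Set.mem_add.2 ⟨_, ⟨β, rfl⟩, _, support_weight_subset β f hr, add_sub_cancel _ _⟩
  finite_co_support' r := by
    have hfin := Set.AddAntidiagonal.finite_of_isPWO isPWO_range_dagger f.isPWO_support r
    refine Set.Finite.of_finite_image (f := fun β =>
      (OrderDual.toDual (ellDaggerExp β), r - OrderDual.toDual (ellDaggerExp β)))
      (hfin.subset ?_) ?_
    · rintro _ ⟨β, hβ, rfl⟩
      rw [Set.mem_ofPred_eq, coeff_dagger_mul] at hβ
      exact ⟨⟨β, rfl⟩, support_weight_subset β f hβ, add_sub_cancel _ _⟩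
    · intro α _ β _ h
      exact ellDaggerExp_injective (congrArg Prod.fst h)

/-- `∑_r f_r ℓ^r ↦ ∑_β ℓ_β^† ∑_r r_β f_r ℓ^r`. -/
def derSeries : Series.{u} →ₗ[ℝ] Series.{u} where
  toFun f := (derFamily f).hsum
  map_add' f g := by
    rw [← HahnSeries.SummableFamily.hsum_add]
    congr 1
    ext1 β
    simp [derFamily, mul_add]
  map_smul' c f := by
    ext r
    simp only [RingHom.id_apply, HahnSeries.coeff_smul, HahnSeries.SummableFamily.coeff_hsum,
      smul_eq_mul]
    rw [← smul_eq_mul, smul_finsum]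
    refine finsum_congr fun β => ?_
    change (dagger β * weight β (c • f)).coeff r = c * (dagger β * weight β f).coeff r
    simp only [coeff_dagger_mul, weight_coeff, HahnSeries.coeff_smul, smul_eq_mul]
    ring

lemma derSeries_mul (f g : Series.{u}) :
    derSeries (f * g) = f * derSeries g + g * derSeries f := by
  change (derFamily (f * g)).hsum = f * (derFamily g).hsum + g * (derFamily f).hsum
  rw [← HahnSeries.SummableFamily.hsum_smul, ← HahnSeries.SummableFamily.hsum_smul,
    ← HahnSeries.SummableFamily.hsum_add]
  congr 1
  ext1 β
  change dagger β * weight β (f * g)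
    = f * (dagger β * weight β g) + g * (dagger β * weight β f)
  rw [weight_mul]
  ring

lemma IsBelow.derSeries {α : Ordinal.{u}} {f : Series.{u}} (hf : IsBelow α f) :
    IsBelow α (derSeries f) := by
  intro r hr
  obtain ⟨β, hβ⟩ := Set.mem_iUnion.1 (HahnSeries.SummableFamily.support_hsum_subset hr)
  change (dagger β * weight β f).coeff r ≠ 0 at hβ
  rw [coeff_dagger_mul] at hβ
  have h1 := hf _ (support_weight_subset β f hβ)
  have h2 : β < α := by
    by_contra h
    exact left_ne_zero_of_mul hβ (h1 β (not_lt.1 h))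
  have h3 := exponentsBelow_mono (Order.succ_le_of_lt h2) (ellDerivExp_mem (Order.succ β))
  have h4 := (exponentsBelow α).add_mem h3 h1
  have h5 : ellDerivExp (Order.succ β)
      + OrderDual.ofDual (r - OrderDual.toDual (ellDaggerExp β)) = OrderDual.ofDual r :=
    add_sub_cancel (ellDaggerExp β) (OrderDual.ofDual r)
  rwa [h5] at h4

/-- The derivation `∂` on `𝕃`: `∂ (∑_r f_r ℓ^r) = ∑_r f_r ∑_β r_β ℓ^r ∏_{γ≤β} ℓ_γ⁻¹`. -/
def der : Derivation ℝ LL.{u} LL.{u} :=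
  Derivation.mk'
    { toFun := fun f => ⟨derSeries f.1, by
        obtain ⟨α, hα⟩ := f.2
        exact ⟨α, hα.derSeries⟩⟩
      map_add' := fun f g => Subtype.ext (derSeries.map_add f.1 g.1)
      map_smul' := fun c f => Subtype.ext (derSeries.map_smul c f.1) }
    fun f g => Subtype.ext (derSeries_mul f.1 g.1)

/-- The coefficient of `ℓ^r` in `∂ f`. -/
lemma der_coeff (f : LL.{u}) (r : (Exponents.{u})ᵒᵈ) :
    (der f).1.coeff r = ∑ᶠ β, (dagger β * weight β f.1).coeff r :=
  HahnSeries.SummableFamily.coeff_hsum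

/-- `∂ ℓ^r` is the sum over all `β` of `r_β ℓ^r ∏_{γ≤β} ℓ_γ⁻¹`. -/
lemma derFamily_mono (r : Exponents.{u}) (β : Ordinal.{u}) :
    derFamily (mono r).1 β
      = HahnSeries.single (OrderDual.toDual (ellDaggerExp β + r)) (expo r β) := by
  have hw : weight β (mono r).1 = HahnSeries.single (OrderDual.toDual r) (expo r β) := by
    ext s
    rw [weight_coeff]
    by_cases hs : s = OrderDual.toDual r
    · rw [hs, HahnSeries.coeff_single_same]
      change _ * (HahnSeries.single (OrderDual.toDual r) (1 : ℝ)).coeff _ = _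
      rw [HahnSeries.coeff_single_same, mul_one]
      rfl
    · simp [mono, HahnSeries.coeff_single_of_ne hs]
  change dagger β * weight β (mono r).1 = _
  rw [hw, dagger, HahnSeries.single_mul_single, one_mul, toDual_add]

/-- `∂ ℓ_α = ∏_{β<α} ℓ_β⁻¹`. -/
lemma der_ell (α : Ordinal.{u}) : der (mono (ellExp α)) = mono (ellDerivExp α) := by
  apply Subtype.ext
  ext r
  have hw : ∀ β, weight β (mono (ellExp α)).1 = if β = α then (mono (ellExp α)).1 else 0 := by
    intro β
    ext s
    rw [weight_coeff]
    by_cases hs : s = OrderDual.toDual (ellExp α)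
    · subst hs
      by_cases h : β = α <;> simp [h, mono, expo, ellExp]
    · by_cases h : β = α <;> simp [h, mono, HahnSeries.coeff_single_of_ne hs]
  rw [der_coeff, finsum_eq_single _ α]
  · rw [hw, if_pos rfl]
    change (HahnSeries.single _ _ * HahnSeries.single _ _ : Series.{u}).coeff r = _
    rw [HahnSeries.single_mul_single, one_mul, add_comm, ← toDual_add, ellExp_add_ellDaggerExp]
    rfl
  · intro β hβ
    rw [hw, if_neg hβ, mul_zero, HahnSeries.coeff_zero]

lemma finite_dagger_mul_weight {I : Type*} (s : HahnSeries.SummableFamily (Exponents.{u})ᵒᵈ ℝ I)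
    (r : (Exponents.{u})ᵒᵈ) :
    {p : I × Ordinal.{u} | (dagger p.2 * weight p.2 (s p.1)).coeff r ≠ 0}.Finite := by
  have hfin := Set.AddAntidiagonal.finite_of_isPWO isPWO_range_dagger s.isPWO_iUnion_support r
  have hfin2 := hfin.biUnion (t := fun q => {i | (s i).coeff q.2 ≠ 0} ×ˢ {q.1})
    fun q _ => (s.finite_co_support q.2).prod (Set.finite_singleton _)
  refine Set.Finite.of_finite_image (f := fun p : I × Ordinal.{u} =>
    (p.1, OrderDual.toDual (ellDaggerExp p.2))) (hfin2.subset ?_) ?_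
  · rintro _ ⟨⟨i, β⟩, h, rfl⟩
    rw [Set.mem_ofPred_eq, coeff_dagger_mul] at h
    have h' := support_weight_subset β (s i) h
    exact Set.mem_biUnion (x := (OrderDual.toDual (ellDaggerExp β),
      r - OrderDual.toDual (ellDaggerExp β)))
      ⟨⟨β, rfl⟩, Set.mem_iUnion.2 ⟨i, h'⟩, add_sub_cancel _ _⟩ ⟨h', rfl⟩
  · rintro ⟨i, α⟩ _ ⟨j, β⟩ _ h
    replace h : (i, OrderDual.toDual (ellDaggerExp α)) = (j, OrderDual.toDual (ellDaggerExp β)) := h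
    rw [Prod.mk.injEq] at h
    exact Prod.ext h.1 (ellDaggerExp_injective h.2)

section

open scoped Pointwise

/-- `∂` maps summable families to summable families and commutes with infinite sums. -/
lemma derSeries_hsum {I : Type*} (s : HahnSeries.SummableFamily (Exponents.{u})ᵒᵈ ℝ I) :
    ∃ t : HahnSeries.SummableFamily (Exponents.{u})ᵒᵈ ℝ I,
      (∀ i, t i = derSeries (s i)) ∧ derSeries s.hsum = t.hsum := by
  have hsupp : ∀ f : Series.{u}, (derSeries f).support ⊆
      (Set.range fun β : Ordinal.{u} => OrderDual.toDual (ellDaggerExp β)) + f.support := by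
    intro f r hr
    obtain ⟨β, hβ⟩ := Set.mem_iUnion.1 (HahnSeries.SummableFamily.support_hsum_subset hr)
    change (dagger β * weight β f).coeff r ≠ 0 at hβ
    rw [coeff_dagger_mul] at hβ
    exact Set.mem_add.2 ⟨_, ⟨β, rfl⟩, _, support_weight_subset β f hβ, add_sub_cancel _ _⟩
  have hcoeff : ∀ (f : Series.{u}) r,
      (derSeries f).coeff r = ∑ᶠ β, (dagger β * weight β f).coeff r :=
    fun f r => HahnSeries.SummableFamily.coeff_hsum (s := derFamily f)
  refine ⟨⟨fun i => derSeries (s i), ?_, ?_⟩, fun _ => rfl, ?_⟩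
  · refine (isPWO_range_dagger.add s.isPWO_iUnion_support).mono (Set.iUnion_subset fun i => ?_)
    exact (hsupp (s i)).trans (Set.add_subset_add_left (Set.subset_iUnion_of_subset i subset_rfl))
  · intro r
    refine ((finite_dagger_mul_weight s r).image Prod.fst).subset fun i hi => ?_
    rw [Set.mem_ofPred_eq, hcoeff] at hi
    obtain ⟨β, hβ⟩ : ∃ β, (dagger β * weight β (s i)).coeff r ≠ 0 := by
      by_contra! h
      exact hi ((finsum_congr h).trans finsum_zero)
    exact ⟨(i, β), hβ, rfl⟩
  · ext r
    rw [hcoeff, HahnSeries.SummableFamily.coeff_hsum]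
    change _ = ∑ᶠ i, (derSeries (s i)).coeff r
    have hfin := finite_dagger_mul_weight s r
    have h1 : ∀ β, (dagger β * weight β s.hsum).coeff r
        = ∑ᶠ i, (dagger β * weight β (s i)).coeff r := by
      intro β
      simp only [coeff_dagger_mul, weight_coeff, HahnSeries.SummableFamily.coeff_hsum]
      rw [← smul_eq_mul, smul_finsum]
      rfl
    simp only [h1, hcoeff]
    rw [← finsum_curry (fun p : I × Ordinal.{u} => (dagger p.2 * weight p.2 (s p.1)).coeff r) hfin]
    have hfin' : Function.HasFiniteSupport fun p : Ordinal.{u} × I =>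
        (dagger p.1 * weight p.1 (s p.2)).coeff r :=
      (hfin.image Prod.swap).subset fun p hp => ⟨p.swap, hp, rfl⟩
    rw [← finsum_curry (fun p : Ordinal.{u} × I =>
      (dagger p.1 * weight p.1 (s p.2)).coeff r) hfin']
    exact (finsum_comp_equiv (Equiv.prodComm I Ordinal.{u})
      (f := fun p : Ordinal.{u} × I => (dagger p.1 * weight p.1 (s p.2)).coeff r)).symm

end

/-- An ordered field `K` with derivation `∂` and constant field `C = {c : ∂ c = 0}` is an
`H`-field if (1) `∂ f > 0` for all `f > C`, and (2) every `f` in the convex hull of `C` in `K` is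
of the form `c + ε` with `c ∈ C` and `|ε|` smaller than all positive constants. -/
structure IsHField {R K : Type*} [CommRing R] [Field K] [LinearOrder K] [IsStrictOrderedRing K]
    [Algebra R K] (D : Derivation R K K) : Prop where
  der_pos : ∀ f : K, (∀ c, D c = 0 → c < f) → 0 < D f
  exists_const_add : ∀ f : K, (∃ a b, D a = 0 ∧ D b = 0 ∧ a ≤ f ∧ f ≤ b) →
    ∃ c ε, D c = 0 ∧ (∀ d, D d = 0 → 0 < d → |ε| < d) ∧ f = c + ε

end LogHyper

end

noncomputable section

namespace LogHyper

open OrderDual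

/-! For `r ≠ 0` with first nonzero entry at `β`, the dominant monomial of `∂ℓ^r` is `ℓ^(derExp r)`,
with coefficient `r_β`. The map `derExp` is a strictly increasing bijection from the nonzero
exponents onto all exponents (`derExp_lt_derExp`, `exists_derExp_eq`). So, apart from its constant
term, a series is differentiated without cancellation at the top (`derSeries_coeff_derExp`): this
leaves only real constants and determines the sign of the derivative of an infinite element.

For surjectivity, an antiderivative is built from its largest terms downwards. As long as `f - ∂g`
is nonzero, its dominant monomial is that of some `∂ℓ^r`, and a multiple of `ℓ^r` is added to `g`.
Zorn's lemma runs this transfinitely. If `f` lies in `𝕃_{<α}`, all terms used stay in `𝔏_{<α+1}` and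
their derivatives in `𝕃_{<α}`, so the result remains in `𝕃`. -/

/-! ### ### Exponents and dominant monomials of derivatives -/

lemma lt_iff_expo {r s : Exponents.{u}} :
    r < s ↔ ∃ β, (∀ γ, γ < β → expo r γ = expo s γ) ∧ expo r β < expo s β := Iff.rfl

lemma expo_ext {r s : Exponents.{u}} (h : ∀ β, expo r β = expo s β) : r = s :=
  Subtype.ext (funext h)

lemma expo_ellDaggerExp (β γ : Ordinal.{u}) :
    expo (ellDaggerExp β) γ = if γ ≤ β then -1 else 0 := by
  change (if γ < Order.succ β then (-1 : ℝ) else 0) = _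
  simp only [Order.lt_succ_iff]

/-- The least index at which an exponent sequence does not vanish. -/
def leadIndex (r : Exponents.{u}) : Ordinal.{u} := sInf {β | expo r β ≠ 0}

lemma expo_leadIndex_ne_zero {r : Exponents.{u}} (hr : r ≠ 0) : expo r (leadIndex r) ≠ 0 := by
  refine csInf_mem (s := {β | expo r β ≠ 0}) ?_
  by_contra h
  rw [Set.not_nonempty_iff_eq_empty, Set.eq_empty_iff_forall_notMem] at h
  exact hr (expo_ext fun β => not_not.1 (h β))

lemma expo_eq_zero_of_lt_leadIndex {r : Exponents.{u}} {β : Ordinal.{u}} (h : β < leadIndex r) :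
    expo r β = 0 :=
  not_not.1 fun h' => notMem_of_lt_csInf' h h'

lemma leadIndex_le {r : Exponents.{u}} {β : Ordinal.{u}} (h : expo r β ≠ 0) : leadIndex r ≤ β :=
  csInf_le' h

lemma leadIndex_eq {r : Exponents.{u}} {β : Ordinal.{u}} (h : expo r β ≠ 0)
    (h' : ∀ γ, γ < β → expo r γ = 0) : leadIndex r = β :=
  (leadIndex_le h).antisymm (not_lt.1 fun hlt =>
    expo_leadIndex_ne_zero (by rintro rfl; exact h rfl) (h' _ hlt))

lemma expo_leadIndex_pos {r : Exponents.{u}} (hr : 0 < r) : 0 < expo r (leadIndex r) := by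
  obtain ⟨β, h1, h2⟩ := lt_iff_expo.1 hr
  rw [leadIndex_eq (β := β) (ne_of_gt h2) fun γ hγ => (h1 γ hγ).symm]
  exact h2

/-- The exponent sequence of the dominant monomial of `∂ ℓ^r`, for `r ≠ 0`. -/
def derExp (r : Exponents.{u}) : Exponents.{u} := r + ellDaggerExp (leadIndex r)

lemma expo_derExp_of_lt {r : Exponents.{u}} {β : Ordinal.{u}} (h : β < leadIndex r) :
    expo (derExp r) β = -1 := by
  simp [derExp, expo_ellDaggerExp, h.le, expo_eq_zero_of_lt_leadIndex h]

lemma expo_derExp_leadIndex (r : Exponents.{u}) :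
    expo (derExp r) (leadIndex r) = expo r (leadIndex r) - 1 := by
  simp [derExp, expo_ellDaggerExp, sub_eq_add_neg]

lemma expo_derExp_of_gt {r : Exponents.{u}} {β : Ordinal.{u}} (h : leadIndex r < β) :
    expo (derExp r) β = expo r β := by
  simp [derExp, expo_ellDaggerExp, h.not_ge]

/-- With equal leading indices both sides are translated by the same exponent. Otherwise the
comparison happens at the smaller leading index, where one entry is `-1` and the other is `-1` plus
a leading entry, whose sign is forced by `r < s`. -/
lemma derExp_lt_derExp {r s : Exponents.{u}} (hr : r ≠ 0) (hs : s ≠ 0) (h : r < s) :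
    derExp r < derExp s := by
  rcases lt_trichotomy (leadIndex r) (leadIndex s) with hlt | heq | hlt
  · refine lt_iff_expo.2 ⟨leadIndex r, fun γ hγ => ?_, ?_⟩
    · rw [expo_derExp_of_lt hγ, expo_derExp_of_lt (hγ.trans hlt)]
    · rw [expo_derExp_leadIndex, expo_derExp_of_lt hlt]
      have hneg : expo r (leadIndex r) < 0 := by
        obtain ⟨β, h1, h2⟩ := lt_iff_expo.1 h
        -- The first difference of `r` and `s` can only be at `leadIndex r`, since `s` still
        -- vanishes there.
        rcases lt_trichotomy β (leadIndex r) with hβ | rfl | hβ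
        · rw [expo_eq_zero_of_lt_leadIndex hβ, expo_eq_zero_of_lt_leadIndex (hβ.trans hlt)] at h2
          exact absurd h2 (lt_irrefl _)
        · rwa [expo_eq_zero_of_lt_leadIndex hlt] at h2
        · refine absurd (h1 _ hβ) ?_
          rw [expo_eq_zero_of_lt_leadIndex hlt]
          exact expo_leadIndex_ne_zero hr
      linarith
  · rw [derExp, derExp, heq]
    exact add_lt_add_left h _
  · refine lt_iff_expo.2 ⟨leadIndex s, fun γ hγ => ?_, ?_⟩
    · rw [expo_derExp_of_lt hγ, expo_derExp_of_lt (hγ.trans hlt)]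
    · rw [expo_derExp_leadIndex, expo_derExp_of_lt hlt]
      have hpos : 0 < expo s (leadIndex s) := by
        obtain ⟨β, h1, h2⟩ := lt_iff_expo.1 h
        rcases lt_trichotomy β (leadIndex s) with hβ | rfl | hβ
        · rw [expo_eq_zero_of_lt_leadIndex hβ, expo_eq_zero_of_lt_leadIndex (hβ.trans hlt)] at h2
          exact absurd h2 (lt_irrefl _)
        · rwa [expo_eq_zero_of_lt_leadIndex hlt] at h2
        · refine absurd (h1 _ hβ).symm ?_
          rw [expo_eq_zero_of_lt_leadIndex hlt]
          exact expo_leadIndex_ne_zero hs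
      linarith

lemma derExp_le_derExp {r s : Exponents.{u}} (hr : r ≠ 0) (hs : s ≠ 0) (h : r ≤ s) :
    derExp r ≤ derExp s := by
  rcases h.eq_or_lt with rfl | h
  · exact le_rfl
  · exact (derExp_lt_derExp hr hs h).le

lemma lt_of_derExp_lt {r s : Exponents.{u}} (hr : r ≠ 0) (hs : s ≠ 0)
    (h : derExp r < derExp s) : r < s :=
  not_le.1 fun h' => h.not_ge (derExp_le_derExp hs hr h')

/-- The leading index of the preimage can be read off from `t`: it is the first place where the
entry is not `-1`, which exists because `t` is eventually `0`. -/
lemma exists_derExp_eq (t : Exponents.{u}) : ∃ r, r ≠ 0 ∧ derExp r = t := by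
  obtain ⟨α, hα⟩ := exists_mem_exponentsBelow t
  have hne : {β | expo t β ≠ -1}.Nonempty := ⟨α, by simp [hα α le_rfl]⟩
  set β := sInf {β | expo t β ≠ -1}
  have hβ : expo t β ≠ -1 := csInf_mem hne
  have hlt : ∀ γ, γ < β → expo t γ = -1 := fun γ hγ =>
    not_not.1 fun h => notMem_of_lt_csInf' hγ h
  have h1 : expo (t - ellDaggerExp β) β ≠ 0 := by
    rw [sub_eq_add_neg, expo_add, expo_neg, expo_ellDaggerExp, if_pos le_rfl, neg_neg]
    exact fun h => hβ (eq_neg_of_add_eq_zero_left h)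
  have h2 : leadIndex (t - ellDaggerExp β) = β := leadIndex_eq h1 fun γ hγ => by
    rw [sub_eq_add_neg, expo_add, expo_neg, expo_ellDaggerExp, if_pos hγ.le, hlt γ hγ]
    norm_num
  refine ⟨t - ellDaggerExp β, fun h => h1 (by rw [h]; rfl), ?_⟩
  rw [derExp, h2, sub_add_cancel]

lemma add_ellDaggerExp_le_derExp {r : Exponents.{u}} {β : Ordinal.{u}} (h : expo r β ≠ 0) :
    r + ellDaggerExp β ≤ derExp r :=
  add_le_add_right (ellDaggerExp_antitone (leadIndex_le h)) r

lemma leadIndex_le_of_derExp_mem {r : Exponents.{u}} {α : Ordinal.{u}}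
    (h : derExp r ∈ exponentsBelow α) : leadIndex r ≤ α := by
  by_contra hlt
  have h1 := h α le_rfl
  rw [expo_derExp_of_lt (not_le.1 hlt)] at h1
  norm_num at h1

/-- The successor cannot be avoided: `∂ℓ_α` lies in `𝔏_{<α}` although `ℓ_α` does not. -/
lemma mem_exponentsBelow_of_derExp_mem {r : Exponents.{u}} {α : Ordinal.{u}}
    (h : derExp r ∈ exponentsBelow α) : r ∈ exponentsBelow (Order.succ α) := fun γ hγ => by
  have hlt : α < γ := Order.succ_le_iff.1 hγ
  rw [← expo_derExp_of_gt ((leadIndex_le_of_derExp_mem h).trans_lt hlt)]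
  exact h γ hlt.le

/-- Past the leading index, `derExp r` and `r` have the same entries. Hence any further term of
`∂ℓ^r` comes from an index `β < α`. -/
lemma add_ellDaggerExp_mem {r : Exponents.{u}} {α β : Ordinal.{u}}
    (h : derExp r ∈ exponentsBelow α) (hβ : expo r β ≠ 0) :
    r + ellDaggerExp β ∈ exponentsBelow α := by
  rcases (leadIndex_le hβ).eq_or_lt with rfl | hlt
  · exact h
  have hβα : β < α := by
    by_contra hle
    exact hβ ((expo_derExp_of_gt hlt).symm.trans (h β (not_lt.1 hle)))
  intro γ hγ
  have hβγ := hβα.trans_le hγ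
  rw [expo_add, expo_ellDaggerExp, if_neg hβγ.not_ge, add_zero,
    ← expo_derExp_of_gt (hlt.trans hβγ)]
  exact h γ hγ

/-! ### Coefficients of derivatives -/

lemma derSeries_coeff (f : Series.{u}) (t : Exponents.{u}) :
    (derSeries f).coeff (toDual t) = ∑ᶠ β, expo (t - ellDaggerExp β) β *
      f.coeff (toDual (t - ellDaggerExp β)) := by
  refine (HahnSeries.SummableFamily.coeff_hsum (s := derFamily f)).trans (finsum_congr fun β => ?_)
  change (dagger β * weight β f).coeff (toDual t) = _
  rw [coeff_dagger_mul]
  rfl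

lemma exists_of_derSeries_coeff_ne_zero {f : Series.{u}} {t : Exponents.{u}}
    (h : (derSeries f).coeff (toDual t) ≠ 0) :
    ∃ s β, f.coeff (toDual s) ≠ 0 ∧ expo s β ≠ 0 ∧ t = s + ellDaggerExp β := by
  rw [derSeries_coeff] at h
  obtain ⟨β, hβ⟩ : ∃ β, expo (t - ellDaggerExp β) β *
      f.coeff (toDual (t - ellDaggerExp β)) ≠ 0 := by
    by_contra! h'
    exact h ((finsum_congr h').trans finsum_zero)
  exact ⟨t - ellDaggerExp β, β, right_ne_zero_of_mul hβ, left_ne_zero_of_mul hβ,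
    (sub_add_cancel _ _).symm⟩

lemma ne_zero_of_expo_ne_zero {r : Exponents.{u}} {β : Ordinal.{u}} (h : expo r β ≠ 0) : r ≠ 0 := by
  rintro rfl
  exact h rfl

lemma derSeries_coeff_eq_zero {f : Series.{u}} {t : Exponents.{u}}
    (h : ∀ s, s ≠ 0 → f.coeff (toDual s) ≠ 0 → derExp s < t) :
    (derSeries f).coeff (toDual t) = 0 := by
  by_contra hne
  obtain ⟨s, β, hs, hβ, rfl⟩ := exists_of_derSeries_coeff_ne_zero hne
  exact (h s (ne_zero_of_expo_ne_zero hβ) hs).not_ge (add_ellDaggerExp_le_derExp hβ)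

/-- Terms `s < r` only produce exponents at most `derExp s < derExp r`, and within `∂ℓ^r` distinct
`β` give distinct monomials. The bound exempts `s = 0` because a constant term contributes nothing.
-/
lemma derSeries_coeff_derExp {f : Series.{u}} {r : Exponents.{u}} (hr : r ≠ 0)
    (h : ∀ s, s ≠ 0 → f.coeff (toDual s) ≠ 0 → s ≤ r) :
    (derSeries f).coeff (toDual (derExp r)) = expo r (leadIndex r) * f.coeff (toDual r) := by
  rw [derSeries_coeff, finsum_eq_single _ (leadIndex r)]
  · rw [derExp, add_sub_cancel_right]
  · intro β hβ
    by_contra hne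
    set s := derExp r - ellDaggerExp β with hs
    have h1 := left_ne_zero_of_mul hne
    have h2 := right_ne_zero_of_mul hne
    have h0 := ne_zero_of_expo_ne_zero h1
    have h3 : s + ellDaggerExp β = derExp r := sub_add_cancel _ _
    have hsr : s = r := by
      refine (h s h0 h2).eq_of_not_lt fun hlt => ?_
      have := (add_ellDaggerExp_le_derExp h1).trans_lt (derExp_lt_derExp h0 hr hlt)
      exact this.ne h3
    rw [hsr, derExp] at h3
    exact hβ (ellDaggerExp_injective (add_left_cancel h3))

/-- A nonzero series has a dominant monomial. -/
lemma exists_dominant {f : Series.{u}} (hf : f ≠ 0) :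
    ∃ r : Exponents.{u}, f.coeff (toDual r) ≠ 0 ∧ ∀ s, f.coeff (toDual s) ≠ 0 → s ≤ r :=
  ⟨ofDual f.order, HahnSeries.coeff_order_eq_zero.not.2 hf, fun _ hs =>
    HahnSeries.order_le_of_coeff_ne_zero hs⟩

lemma isBelow_sub {α : Ordinal.{u}} {f g : Series.{u}} (hf : IsBelow α f) (hg : IsBelow α g) :
    IsBelow α (f - g) := fun r hr =>
  (HahnSeries.support_sub_subset _ _ hr).elim (hf r) (hg r)

/-! ### Constants -/

lemma coeff_algebraMap (c : ℝ) {r : Exponents.{u}} (hr : r ≠ 0) :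
    (algebraMap ℝ Series.{u} c).coeff (toDual r) = 0 :=
  HahnSeries.coeff_single_of_ne hr

lemma coeff_algebraMap_zero (c : ℝ) :
    (algebraMap ℝ Series.{u} c).coeff (toDual 0) = c :=
  HahnSeries.coeff_single_same (0 : Exponents.{u}ᵒᵈ) c

lemma derSeries_algebraMap (c : ℝ) : derSeries (algebraMap ℝ Series.{u} c) = 0 := by
  ext t
  exact derSeries_coeff_eq_zero (t := ofDual t) fun s h0 hs => absurd (coeff_algebraMap c h0) hs

/-- If anything remained after removing the constant term, its dominant exponent `r` would be
nonzero, and the derivative would have a nonzero coefficient at `derExp r`. -/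
lemma eq_algebraMap_of_derSeries_eq_zero {f : Series.{u}} (hf : derSeries f = 0) :
    f = algebraMap ℝ Series.{u} (f.coeff 0) := by
  set h := f - algebraMap ℝ Series.{u} (f.coeff 0) with hh
  have hder : derSeries h = 0 := by
    rw [hh, map_sub, hf, zero_sub, neg_eq_zero]
    exact derSeries_algebraMap _
  by_contra hne
  obtain ⟨r, hr, hmax⟩ := exists_dominant (f := h) (sub_ne_zero.2 hne)
  have hr0 : r ≠ 0 := by
    rintro rfl
    refine hr ?_
    rw [hh, HahnSeries.coeff_sub]
    exact sub_eq_zero.2 (HahnSeries.coeff_single_same _ _).symm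
  have := derSeries_coeff_derExp hr0 fun s _ hs => hmax s hs
  rw [hder] at this
  exact mul_ne_zero (expo_leadIndex_ne_zero hr0) hr this.symm

lemma der_eq_zero_iff {f : LL.{u}} : der f = 0 ↔ f ∈ Set.range (algebraMap ℝ LL.{u}) := by
  constructor
  · intro h
    exact ⟨f.1.coeff 0,
      Subtype.ext (eq_algebraMap_of_derSeries_eq_zero (congrArg Subtype.val h)).symm⟩
  · rintro ⟨c, rfl⟩
    exact Subtype.ext (derSeries_algebraMap c)

/-! ### The ordering -/

lemma LL_lt_iff {f g : LL.{u}} : f < g ↔ ∃ r : Exponents.{u},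
    (∀ s, r < s → f.1.coeff (toDual s) = g.1.coeff (toDual s)) ∧
      f.1.coeff (toDual r) < g.1.coeff (toDual r) :=
  HahnSeries.lt_iff (toLex f.1) (toLex g.1)

lemma derSeries_coeff_eq_zero_of_derExp_lt {f : Series.{u}} {r : Exponents.{u}} (hr : r ≠ 0)
    (h : ∀ s, s ≠ 0 → f.coeff (toDual s) ≠ 0 → s ≤ r) {t : Exponents.{u}} (ht : derExp r < t) :
    (derSeries f).coeff (toDual t) = 0 :=
  derSeries_coeff_eq_zero fun s h0 hs => (derExp_le_derExp h0 hr (h s h0 hs)).trans_lt ht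

lemma isHField_der : IsHField der.{u} where
  der_pos f hf := by
    have hf' : ∀ c : ℝ, algebraMap ℝ LL.{u} c < f := fun c => hf _ (der_eq_zero_iff.2 ⟨c, rfl⟩)
    -- Comparing `f` with its own constant term ensures that the deciding exponent `r` is not `0`.
    obtain ⟨r, h1, h2⟩ := LL_lt_iff.1 (hf' (f.1.coeff (toDual 0)))
    have hr0 : r ≠ 0 := by
      rintro rfl
      exact h2.ne (coeff_algebraMap_zero _)
    have hr : 0 < r := by
      refine (lt_or_gt_of_ne hr0).resolve_left fun hneg => ?_
      -- If `r < 0`, then `f` is its constant term plus an infinitesimal, so adding `1` to that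
      -- constant overtakes `f`.
      refine (hf' (f.1.coeff (toDual 0) + 1)).not_gt (LL_lt_iff.2 ⟨0, fun s hs => ?_, ?_⟩)
      · rw [← h1 s (hneg.trans hs)]
        exact (coeff_algebraMap _ hs.ne').trans (coeff_algebraMap _ hs.ne').symm
      · refine (lt_add_one _).trans_eq (coeff_algebraMap_zero _).symm
    have hpos : 0 < f.1.coeff (toDual r) := (coeff_algebraMap _ hr0).symm.trans_lt h2
    have hle : ∀ s, s ≠ 0 → f.1.coeff (toDual s) ≠ 0 → s ≤ r := fun s h0 hs =>
      not_lt.1 fun hlt => hs ((h1 s hlt).symm.trans (coeff_algebraMap _ h0))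
    refine LL_lt_iff.2 ⟨derExp r, fun s hs => ?_, ?_⟩
    · exact (derSeries_coeff_eq_zero_of_derExp_lt hr0 hle hs).symm
    · exact (mul_pos (expo_leadIndex_pos hr) hpos).trans_eq (derSeries_coeff_derExp hr0 hle).symm
  exists_const_add f := by
    rintro ⟨a, b, ha, hb, haf, hfb⟩
    obtain ⟨a, rfl⟩ := der_eq_zero_iff.1 ha
    obtain ⟨b, rfl⟩ := der_eq_zero_iff.1 hb
    -- A dominant exponent `r > 0` would put `f` above or below all reals, according to the sign of
    -- its coefficient.
    have hsupp : ∀ s, 0 < s → f.1.coeff (toDual s) = 0 := by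
      intro s hs
      by_contra hne
      obtain ⟨r, hr, hmax⟩ := exists_dominant (f := f.1) (by rintro h; exact hne (by rw [h]; rfl))
      have hr0 : 0 < r := hs.trans_le (hmax s hne)
      have hgt : ∀ c : ℝ, ∀ q, r < q →
          (algebraMap ℝ LL.{u} c).1.coeff (toDual q) = f.1.coeff (toDual q) := fun c q hq =>
        (coeff_algebraMap c (hr0.trans hq).ne').trans
          (not_not.1 fun h => (hmax q (Ne.symm h)).not_gt hq)
      rcases lt_or_gt_of_ne hr with hr' | hr'
      · exact haf.not_gt (LL_lt_iff.2 ⟨r, fun q hq => (hgt a q hq).symm,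
          hr'.trans_eq (coeff_algebraMap a hr0.ne').symm⟩)
      · exact hfb.not_gt (LL_lt_iff.2 ⟨r, hgt b, (coeff_algebraMap b hr0.ne').trans_lt hr'⟩)
    set c := algebraMap ℝ LL.{u} (f.1.coeff (toDual 0)) with hc
    have hε : ∀ s, 0 < s → (f - c).1.coeff (toDual s) = 0 := fun s hs => by
      change f.1.coeff _ - c.1.coeff _ = 0
      rw [hsupp s hs, zero_sub, neg_eq_zero]
      exact coeff_algebraMap _ hs.ne'
    have hε0 : (f - c).1.coeff (toDual 0) = 0 := by
      change f.1.coeff _ - c.1.coeff _ = 0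
      exact sub_eq_zero.2 (coeff_algebraMap_zero _).symm
    refine ⟨c, f - c, der_eq_zero_iff.2 ⟨_, rfl⟩, fun d hd hdpos => ?_, (add_sub_cancel _ _).symm⟩
    obtain ⟨d, rfl⟩ := der_eq_zero_iff.1 hd
    have hdpos' : 0 < d := by
      obtain ⟨r, -, h2⟩ := LL_lt_iff.1 hdpos
      by_cases hr : r = 0
      · subst hr
        exact h2.trans_eq (coeff_algebraMap_zero d)
      · exact absurd (coeff_algebraMap d hr).symm h2.ne
    rw [abs_lt]
    refine ⟨LL_lt_iff.2 ⟨0, fun s hs => ?_, ?_⟩, LL_lt_iff.2 ⟨0, fun s hs => ?_, ?_⟩⟩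
    · rw [hε s hs]
      exact neg_eq_zero.2 (coeff_algebraMap d hs.ne')
    · rw [hε0]
      exact neg_neg_iff_pos.2 (hdpos'.trans_eq (coeff_algebraMap_zero d).symm)
    · rw [hε s hs]
      exact (coeff_algebraMap d hs.ne').symm
    · rw [hε0]
      exact hdpos'.trans_eq (coeff_algebraMap_zero d).symm

/-! ### Integration -/

/-- `g` is a truncation of an antiderivative of `f`, with zero constant term: the derivative of each
of its monomials has its dominant monomial in `𝔏_{<α}`, and this monomial strictly dominates
`f - ∂ g`. -/
def IsPartialIntegral (α : Ordinal.{u}) (f g : Series.{u}) : Prop :=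
  ∀ r, g.coeff (toDual r) ≠ 0 → r ≠ 0 ∧ derExp r ∈ exponentsBelow α ∧
    ∀ t, derExp r ≤ t → (f - derSeries g).coeff (toDual t) = 0

/-- `g'` extends `g` by terms smaller than all terms of `g`. -/
def IsExtension (g g' : Series.{u}) : Prop :=
  ∀ s, g.coeff (toDual s) ≠ 0 → ∀ r, s ≤ r → g'.coeff (toDual r) = g.coeff (toDual r)

lemma IsExtension.refl (g : Series.{u}) : IsExtension g g := fun _ _ _ _ => rfl

lemma IsExtension.trans {f g h : Series.{u}} (h1 : IsExtension f g) (h2 : IsExtension g h) :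
    IsExtension f h := fun s hs r hr => by
  rw [h2 s (by rwa [h1 s hs s le_rfl]) r hr, h1 s hs r hr]

/-- Members of the chain agree on overlaps and only grow downwards, so their coefficients glue. The
choice of member in `F` is therefore immaterial. -/
lemma exists_isExtension_of_chain (c : Set Series.{u})
    (hc : ∀ g ∈ c, ∀ h ∈ c, IsExtension g h ∨ IsExtension h g) :
    ∃ u : Series.{u}, (∀ g ∈ c, IsExtension g u) ∧
      ∀ r, u.coeff (toDual r) ≠ 0 → ∃ g ∈ c, g.coeff (toDual r) ≠ 0 := by
  classical
  let F : Exponents.{u}ᵒᵈ → ℝ := fun r =>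
    if h : ∃ g ∈ c, g.coeff r ≠ 0 then h.choose.coeff r else 0
  have hF : ∀ g ∈ c, ∀ r, g.coeff r ≠ 0 → F r = g.coeff r := by
    intro g hg r hr
    have h : ∃ g ∈ c, g.coeff r ≠ 0 := ⟨g, hg, hr⟩
    have hFr : F r = h.choose.coeff r := dif_pos h
    obtain ⟨hg', hr'⟩ := h.choose_spec
    rw [hFr]
    rcases hc g hg _ hg' with h1 | h1
    · exact h1 (ofDual r) hr (ofDual r) le_rfl
    · exact (h1 (ofDual r) hr' (ofDual r) le_rfl).symm
  have hF' : ∀ r, F r ≠ 0 → ∃ g ∈ c, g.coeff r ≠ 0 := fun r hr => by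
    by_contra h
    exact hr (dif_neg h)
  have hext : ∀ g ∈ c, ∀ s, g.coeff (toDual s) ≠ 0 → ∀ r, s ≤ r →
      F (toDual r) = g.coeff (toDual r) := by
    intro g hg s hs r hr
    by_cases hgr : g.coeff (toDual r) = 0
    · rw [hgr]
      by_contra hne
      obtain ⟨g', hg', hr'⟩ := hF' _ hne
      rcases hc g hg g' hg' with h1 | h1
      · exact hr' ((h1 s hs r hr).trans hgr)
      · exact hr' ((h1 r hr' r le_rfl).symm.trans hgr)
    · exact hF g hg _ hgr
  have hpwo : F.support.IsPWO := by
    rw [Set.isPWO_iff_isWF]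
    -- A member whose support contains the first term of the sequence agrees with `F` on all larger
    -- monomials, so its support contains the whole sequence.
    refine Set.isWF_iff_no_descending_seq.2 fun s hs hmem => ?_
    obtain ⟨g, hg, h0⟩ := hF' _ (hmem 0)
    refine Set.isWF_iff_no_descending_seq.1 g.isWF_support s hs fun n => ?_
    change g.coeff (toDual (ofDual (s n))) ≠ 0
    rw [← hext g hg (ofDual (s 0)) h0 (ofDual (s n)) (hs.antitone (Nat.zero_le n))]
    exact hmem n
  exact ⟨⟨F, hpwo⟩, hext, fun r hr => hF' _ hr⟩

/-- All terms of `u - g` lie strictly below `r`, so its derivative lies strictly below `derExp r`.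
-/
lemma derSeries_coeff_eq_of_isExtension {g u : Series.{u}} (h : IsExtension g u)
    {r t : Exponents.{u}} (hr : g.coeff (toDual r) ≠ 0) (hr0 : r ≠ 0) (ht : derExp r ≤ t) :
    (derSeries u).coeff (toDual t) = (derSeries g).coeff (toDual t) := by
  have h1 : (derSeries (u - g)).coeff (toDual t) = 0 := by
    refine derSeries_coeff_eq_zero fun s h0 hs => (derExp_lt_derExp h0 hr0 ?_).trans_le ht
    by_contra hle
    refine hs ?_
    rw [HahnSeries.coeff_sub, h r hr s (not_lt.1 hle), sub_self]
  rwa [map_sub, HahnSeries.coeff_sub, sub_eq_zero] at h1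

lemma IsPartialIntegral.isBelow_derSeries {α : Ordinal.{u}} {f g : Series.{u}}
    (h : IsPartialIntegral α f g) : IsBelow α (derSeries g) := by
  intro t ht
  obtain ⟨s, β, hs, hβ, hst⟩ := exists_of_derSeries_coeff_ne_zero (t := ofDual t) ht
  rw [hst]
  exact add_ellDaggerExp_mem (h s hs).2.1 hβ

lemma IsPartialIntegral.isBelow {α : Ordinal.{u}} {f g : Series.{u}}
    (h : IsPartialIntegral α f g) : IsBelow (Order.succ α) g := fun r hr =>
  mem_exponentsBelow_of_derExp_mem (h (ofDual r) hr).2.1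

lemma IsPartialIntegral.exists_isExtension {α : Ordinal.{u}} {f g : Series.{u}}
    (hf : IsBelow α f) (hg : IsPartialIntegral α f g) (hne : f - derSeries g ≠ 0) :
    ∃ g', IsPartialIntegral α f g' ∧ IsExtension g g' ∧ ¬ IsExtension g' g := by
  obtain ⟨t, ht, hmax⟩ := exists_dominant hne
  have htα : t ∈ exponentsBelow α := isBelow_sub hf hg.isBelow_derSeries _ ht
  obtain ⟨r, hr0, rfl⟩ := exists_derExp_eq t
  -- The remainder vanishes from `derExp s` upwards but not at `derExp r`; thus the new term lies
  -- below all of `g`.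
  have hlt : ∀ s, g.coeff (toDual s) ≠ 0 → r < s := fun s hs => by
    obtain ⟨hs0, -, h⟩ := hg s hs
    exact lt_of_derExp_lt hr0 hs0 (not_le.1 fun hle => ht (h _ hle))
  have hgr : g.coeff (toDual r) = 0 := not_not.1 fun h => lt_irrefl _ (hlt r h)
  set a := (f - derSeries g).coeff (toDual (derExp r))
  have hlead := expo_leadIndex_ne_zero hr0
  -- Dividing by the leading coefficient of `∂ℓ^r` makes `∂p` cancel the dominant term of `f - ∂g`.
  set p : Series.{u} := HahnSeries.single (toDual r) (a / expo r (leadIndex r)) with hp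
  have hpr : p.coeff (toDual r) = a / expo r (leadIndex r) := HahnSeries.coeff_single_same _ _
  have hpne : ∀ s, s ≠ r → p.coeff (toDual s) = 0 := fun s hs => HahnSeries.coeff_single_of_ne hs
  have hple : ∀ s, s ≠ 0 → p.coeff (toDual s) ≠ 0 → s ≤ r := fun s _ hs =>
    (not_not.1 fun h => hs (hpne s h)).le
  have hzero : ∀ t, derExp r ≤ t → (f - derSeries (g + p)).coeff (toDual t) = 0 := by
    intro t htr
    rw [map_add, ← sub_sub, HahnSeries.coeff_sub, sub_eq_zero]
    rcases htr.eq_or_lt with rfl | htr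
    · rw [derSeries_coeff_derExp hr0 hple, hpr, mul_div_cancel₀ _ hlead]
    · rw [derSeries_coeff_eq_zero_of_derExp_lt hr0 hple htr]
      exact not_not.1 fun h => (hmax t h).not_gt htr
  refine ⟨g + p, fun s hs => ?_, fun s hs q hq => ?_, fun h => ?_⟩
  · by_cases hsr : s = r
    · subst hsr
      exact ⟨hr0, htα, hzero⟩
    · rw [HahnSeries.coeff_add, hpne s hsr, add_zero] at hs
      obtain ⟨h0, h1, -⟩ := hg s hs
      exact ⟨h0, h1, fun t ht => hzero t ((derExp_lt_derExp hr0 h0 (hlt s hs)).le.trans ht)⟩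
  · rw [HahnSeries.coeff_add, hpne q ((hlt s hs).trans_le hq).ne', add_zero]
  · have h1 : (g + p).coeff (toDual r) ≠ 0 := by
      rw [HahnSeries.coeff_add, hgr, zero_add, hpr]
      exact div_ne_zero ht hlead
    exact h1 ((h r h1 r le_rfl).symm.trans hgr)

/-- Zorn's lemma for partial integrals under extension, with `α` fixed so that suprema of chains
keep the bound on supports. A maximal one leaves no remainder, since a nonzero remainder allows a
proper extension. -/
lemma exists_derSeries_eq {α : Ordinal.{u}} {f : Series.{u}} (hf : IsBelow α f) :
    ∃ g, IsBelow (Order.succ α) g ∧ g.coeff (toDual 0) = 0 ∧ derSeries g = f := by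
  obtain ⟨⟨g, hg⟩, hmax⟩ := exists_maximal_of_chains_bounded
    (r := fun g h : {g : Series.{u} // IsPartialIntegral α f g} => IsExtension g.1 h.1)
    (fun c hc => by
      obtain ⟨v, hv, hsupp⟩ := exists_isExtension_of_chain (Subtype.val '' c) (by
        rintro _ ⟨g, hg, rfl⟩ _ ⟨h, hh, rfl⟩
        by_cases hgh : g = h
        · subst hgh
          exact Or.inl (IsExtension.refl _)
        · exact hc hg hh hgh)
      refine ⟨⟨v, fun r hr => ?_⟩, fun g hg => hv _ ⟨g, hg, rfl⟩⟩
      obtain ⟨_, ⟨g, hg, rfl⟩, hgr⟩ := hsupp r hr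
      obtain ⟨h0, h1, h2⟩ := g.2 r hgr
      -- From `derExp r` upwards, the glued series and the member containing `r` have the same
      -- derivative.
      refine ⟨h0, h1, fun t ht => ?_⟩
      rw [HahnSeries.coeff_sub, derSeries_coeff_eq_of_isExtension (hv _ ⟨g, hg, rfl⟩) hgr h0 ht,
        ← HahnSeries.coeff_sub, h2 t ht])
    (fun h1 h2 => h1.trans h2)
  refine ⟨g, hg.isBelow, not_not.1 fun h => (hg 0 h).1 rfl, ?_⟩
  by_contra hne
  obtain ⟨g', hg', h1, h2⟩ := hg.exists_isExtension hf (sub_ne_zero.2 (Ne.symm hne))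
  exact h2 (hmax ⟨g', hg'⟩ h1)

lemma exists_der_eq (f : LL.{u}) : ∃ g : LL.{u}, der g = f ∧ (0 : Exponents.{u}) ∉ supp g := by
  obtain ⟨α, hα⟩ := f.2
  obtain ⟨g, hg, h0, hd⟩ := exists_derSeries_eq hα
  exact ⟨⟨g, _, hg⟩, Subtype.ext hd, not_not.2 h0⟩

lemma eq_of_der_eq {g h : LL.{u}} (hd : der g = der h) (hg : (0 : Exponents.{u}) ∉ supp g)
    (hh : (0 : Exponents.{u}) ∉ supp h) : g = h := by
  have h1 : derSeries (g.1 - h.1) = 0 := by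
    rw [map_sub, sub_eq_zero]
    exact congrArg Subtype.val hd
  have h2 := eq_algebraMap_of_derSeries_eq_zero h1
  have h3 : (g.1 - h.1).coeff 0 = 0 := by
    rw [HahnSeries.coeff_sub]
    exact sub_eq_zero.2 ((not_not.1 hg).trans (not_not.1 hh).symm)
  rw [h3, map_zero, sub_eq_zero] at h2
  exact Subtype.ext h2

end LogHyper

end

theorem mainTheorem2 :
    {f : LogHyper.LL.{u} | LogHyper.der f = 0} = Set.range (algebraMap ℝ LogHyper.LL.{u}) ∧
    LogHyper.IsHField LogHyper.der.{u} ∧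
    Function.Surjective LogHyper.der.{u} ∧
    ∃ integ : LogHyper.LL.{u} → LogHyper.LL.{u}, ∀ f g : LogHyper.LL.{u},
      g = integ f ↔ LogHyper.der g = f ∧ (0 : LogHyper.Exponents.{u}) ∉ LogHyper.supp g := by
  refine ⟨Set.ext fun f => LogHyper.der_eq_zero_iff, LogHyper.isHField_der,
    fun f => (LogHyper.exists_der_eq f).imp fun _ h => h.1, ?_⟩
  choose integ h1 h2 using LogHyper.exists_der_eq.{u}
  refine ⟨integ, fun f g => ⟨?_, fun h => ?_⟩⟩
  · rintro rfl
    exact ⟨h1 f, h2 f⟩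
  · exact LogHyper.eq_of_der_eq (h.1.trans (h1 f).symm) h.2 (h2 f)
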